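/- Let $\mathbb C^{2,1}$ be $\mathbb C^3$ with the Hermitian form $\langle z,w\rangle=z_1\bar w_1+z_2\bar w_2-z_3\bar w_3$, and let $H^2_{\mathbb C}$ be the complex hyperbolic plane, i.e. the set of lines $[z]$ with $\langle z,z\rangle<0$, with the Bergman distance $\rho$ given by \[\cosh^2\left(\frac{\rho([z],[w])}{2}\right)=\frac{\langle z,w\rangle\langle w,z\rangle}{\langle z,z\rangle\langle w,w\rangle}.\] Let $PU(2,1)$ be the group of linear automorphisms of $\mathbb C^3$ preserving $\langle\cdot,\cdot\rangle$, modulo scalars, with the quotient topology. A vector $c$ with $\langle c,c\rangle=1$ is a normalised polar vector of the complex geodesic $C=\{[z]\in H^2_{\mathbb C}:\langle c,z\rangle=0\}$. A complex reflection of order $n$ in $C$ is the element of $PU(2,1)$ induced by \[z\mapsto -z+(1-\mu)\frac{\langle z,c\rangle}{\langle c,c\rangle}\,c,\] where $\mu$ is a primitive $n$-th root of unity. Let $m$ be a real number and let $C_1,C_2,C_3$ be complex geodesics with normalised polar vectors $c_1,c_2,c_3$ that are pairwise disjoint in $H^2_{\mathbb C}$ and satisfy $\operatorname{dist}(C_2,C_3)=\operatorname{dist}(C_3,C_1)=m$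 and $\operatorname{dist}(C_1,C_2)=0$, where $\operatorname{dist}$ denotes the infimum of the distances $\rho$ between points of the two geodesics. Let \[\alpha=\arg\bigl(\langle c_3,c_2\rangle\langle c_1,c_3\rangle\langle c_2,c_1\rangle\bigr)\pmod{2\pi}\] be the angular invariant of $(C_1,C_2,C_3)$. Let $\iota_1,\iota_2,\iota_3$ be complex reflections of orders $3,3,2$ in $C_1,C_2,C_3$ respectively, and let $\Gamma=\langle\iota_1,\iota_2,\iota_3\rangle\subset PU(2,1)$ (an ultra-parallel triangle group of type $[m,m,0;3,3,2]$). If \[\cos(\alpha)\le-\frac12\quad\text{and}\quad\cosh\left(\frac m2\right)\ge\frac{2}{\sqrt3},\] then $\Gamma$ is a discrete subgroup of $PU(2,1)$. -/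

import Mathlib

open scoped Matrix

noncomputable section

namespace ComplexHyperbolic

/-- The Hermitian form `⟨z, w⟩ = z₁ w̄₁ + z₂ w̄₂ - z₃ w̄₃` of signature `(2, 1)` on `ℂ³`. -/
def herm (z w : Fin 3 → ℂ) : ℂ :=
  z 0 * star (w 0) + z 1 * star (w 1) - z 2 * star (w 2)

/-- The complex hyperbolic plane: the negative lines of `ℂ^{2,1}`. -/
def HC2 : Type :=
  {p : Projectivization ℂ (Fin 3 → ℂ) // (herm p.rep p.rep).re < 0}

/-- A negative vector representing a point of the complex hyperbolic plane. -/
def HC2.vec (p : HC2) : Fin 3 → ℂ := p.1.rep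

/-- The Bergman distance, normalised by
`cosh² (ρ([z], [w]) / 2) = ⟨z, w⟩ ⟨w, z⟩ / (⟨z, z⟩ ⟨w, w⟩)`. -/
def bergmanDist (p q : HC2) : ℝ :=
  2 * Real.arcosh (Real.sqrt
    ((herm p.vec q.vec * herm q.vec p.vec) /
      (herm p.vec p.vec * herm q.vec q.vec)).re)

/-- The complex geodesic with polar vector `c` (meaningful for positive `c`). -/
def complexGeodesic (c : Fin 3 → ℂ) : Set HC2 :=
  {p | herm c p.vec = 0}

/-- The distance between two sets of points, as the infimum of the Bergman distances. -/
def setDist (C D : Set HC2) : ℝ :=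
  sInf {d : ℝ | ∃ p ∈ C, ∃ q ∈ D, d = bergmanDist p q}

/-- The unitary group `U(2, 1)` of the form `herm`. -/
def U21 : Subgroup (GL (Fin 3) ℂ) where
  carrier := {A | ∀ z w : Fin 3 → ℂ, herm (A.1 *ᵥ z) (A.1 *ᵥ w) = herm z w}
  one_mem' := by
    intro z w
    simp
  mul_mem' := by
    intro A B hA hB z w
    simp only [Units.val_mul, ← Matrix.mulVec_mulVec]
    rw [hA, hB]
  inv_mem' := by
    intro A hA z w
    have h : ∀ v : Fin 3 → ℂ, A.1 *ᵥ ((A⁻¹).1 *ᵥ v) = v := by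
      intro v
      rw [Matrix.mulVec_mulVec, ← Units.val_mul, mul_inv_cancel, Units.val_one,
        Matrix.one_mulVec]
    have := hA ((A⁻¹).1 *ᵥ z) ((A⁻¹).1 *ᵥ w)
    rw [h, h] at this
    exact this.symm

/-- The scalar matrices in `U(2, 1)`. -/
def scalarU21 : Subgroup U21 where
  carrier := {A | ∃ a : ℂ, (A.1.1 : Matrix (Fin 3) (Fin 3) ℂ) = a • 1}
  one_mem' := ⟨1, by simp⟩
  mul_mem' := by
    rintro A B ⟨a, ha⟩ ⟨b, hb⟩
    refine ⟨a * b, ?_⟩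
    simp [ha, hb, smul_smul, mul_comm]
  inv_mem' := by
    rintro A ⟨a, ha⟩
    have h : (A.1.1 : Matrix (Fin 3) (Fin 3) ℂ) * (A⁻¹).1.1 = 1 := by
      have : A.1 * (A⁻¹).1 = 1 := by simp
      rw [← Units.val_mul, this, Units.val_one]
    rw [ha, Matrix.smul_mul, one_mul] at h
    have ha0 : a ≠ 0 := by
      rintro rfl
      simp at h
    refine ⟨a⁻¹, ?_⟩
    rw [← h, smul_smul, inv_mul_cancel₀ ha0, one_smul]

instance scalarU21_normal : scalarU21.Normal where
  conj_mem := by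
    rintro A ⟨a, ha⟩ g
    refine ⟨a, ?_⟩
    have h : (g.1.1 : Matrix (Fin 3) (Fin 3) ℂ) * (g⁻¹).1.1 = 1 := by
      have : g.1 * (g⁻¹).1 = 1 := by simp
      rw [← Units.val_mul, this, Units.val_one]
    change (g.1.1 : Matrix (Fin 3) (Fin 3) ℂ) * A.1.1 * (g⁻¹).1.1 = a • 1
    rw [ha, Matrix.mul_smul, mul_one, Matrix.smul_mul, h]

/-- The projective unitary group `PU(2, 1) = U(2, 1) / scalars`, with the quotient topology. -/
abbrev PU21 : Type := U21 ⧸ scalarU21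

/-- `g` is a complex reflection of order `n` in the complex geodesic with polar vector `c`: it is
the class of `z ↦ -z + (1 - μ) (⟨z, c⟩ / ⟨c, c⟩) c` for a primitive `n`-th root of unity `μ`.
The minimal reflection is the one with `μ = exp (2πi/n)`. -/
def IsComplexReflection (n : ℕ) (c : Fin 3 → ℂ) (g : PU21) : Prop :=
  ∃ μ : ℂ, IsPrimitiveRoot μ n ∧ ∃ A : U21, (QuotientGroup.mk A : PU21) = g ∧
    ∀ z : Fin 3 → ℂ, A.1.1 *ᵥ z = -z + ((1 - μ) * (herm z c / herm c c)) • c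

/-- The complex geodesics with normalised polar vectors `c 0, c 1, c 2` form an ultra-parallel
`[m 0, m 1, m 2]`-triangle: they are pairwise disjoint in the complex hyperbolic plane, and `m k`
is the distance between the two sides other than the `k`-th. Indices are taken modulo 3. -/
structure IsUltraParallelTriangle (m : Fin 3 → ℝ) (c : Fin 3 → Fin 3 → ℂ) : Prop where
  normalised : ∀ k, herm (c k) (c k) = 1
  disjoint : ∀ k, Disjoint (complexGeodesic (c (k - 1))) (complexGeodesic (c (k + 1)))
  dist_eq : ∀ k, setDist (complexGeodesic (c (k - 1))) (complexGeodesic (c (k + 1))) = m k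

/-- The angular invariant of a triangle with normalised polar vectors `c`, modulo `2π`. -/
def angularInvariant (c : Fin 3 → Fin 3 → ℂ) : Real.Angle :=
  (Complex.arg (∏ k, herm (c (k - 1)) (c (k + 1))) : Real.Angle)

/-- `Γ` is an ultra-parallel triangle group of type `[m 0, m 1, m 2; n 0, n 1, n 2]` with angular
invariant `α`. -/
def IsUltraParallelTriangleGroup (m : Fin 3 → ℝ) (n : Fin 3 → ℕ) (α : ℝ)
    (Γ : Subgroup PU21) : Prop :=
  ∃ c : Fin 3 → Fin 3 → ℂ, IsUltraParallelTriangle m c ∧ angularInvariant c = (α : Real.Angle) ∧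
    ∃ ι : Fin 3 → PU21, (∀ k, IsComplexReflection (n k) (c k) (ι k)) ∧
      Γ = Subgroup.closure (Set.range ι)

end ComplexHyperbolic

end

/-!
The geodesics `C₁` and `C₂` are asymptotic, so their polar vectors can be normalised to have
product `1`; their difference `q` is then a null vector representing the common boundary point. In
Heisenberg coordinates with `q` at infinity, the order `3` reflections in `C₁` and `C₂` become, up
to scalars, Heisenberg isometries whose entries are Eisenstein integers. They lie in a discrete
group `P`, which acts on the horizontal plane through a `(3, 3, 3)`-triangle group.

The order `2` reflection `J` in `C₃` exchanges the interior and the exterior of the isometric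
sphere centred at `J q`. The bound on `cos α` says that the horizontal projection of the centre
lies in the Voronoi cell of the origin, so that every horizontally nontrivial element of `P`
displaces it by at least `√3` times its distance to the origin; the bound on `cosh (m / 2)` says
that the radius is small compared with this displacement. Hence the sphere is disjoint from its
translates under `P`, and by ping-pong every element of `⟨P, J⟩` outside `P` moves `q` by a definite
amount. An element of `⟨P, J⟩` near the identity therefore lies in the discrete group `P`.
-/

open scoped ComplexConjugate

namespace ComplexHyperbolic

/-! ### The Hermitian form -/

section HermitianForm

variable (x y z : Fin 3 → ℂ) (a : ℂ)

@[simp]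
lemma herm_zero_left : herm 0 x = 0 := by simp [herm]

@[simp]
lemma herm_add_left : herm (x + y) z = herm x z + herm y z := by
  simp only [herm, Pi.add_apply]; ring

@[simp]
lemma herm_neg_left : herm (-x) z = -herm x z := by
  simp only [herm, Pi.neg_apply]; ring

@[simp]
lemma herm_sub_left : herm (x - y) z = herm x z - herm y z := by
  simp only [sub_eq_add_neg, herm_add_left, herm_neg_left]

@[simp]
lemma herm_smul_left : herm (a • x) z = a * herm x z := by
  simp only [herm, Pi.smul_apply, smul_eq_mul]; ring

@[simp]
lemma herm_conj : conj (herm x y) = herm y x := by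
  simp only [herm, Complex.star_def, map_add, map_sub, map_mul, Complex.conj_conj]; ring

@[simp]
lemma herm_add_right : herm x (y + z) = herm x y + herm x z := by
  rw [← herm_conj, herm_add_left, map_add, herm_conj, herm_conj]

@[simp]
lemma herm_neg_right : herm x (-z) = -herm x z := by
  rw [← herm_conj, herm_neg_left, map_neg, herm_conj]

@[simp]
lemma herm_sub_right : herm x (y - z) = herm x y - herm x z := by
  rw [← herm_conj, herm_sub_left, map_sub, herm_conj, herm_conj]

@[simp]
lemma herm_smul_right : herm x (a • z) = conj a * herm x z := by
  rw [← herm_conj, herm_smul_left, map_mul, herm_conj]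

lemma norm_herm_comm : ‖herm x y‖ = ‖herm y x‖ := by
  rw [← herm_conj y x, Complex.norm_conj]

lemma herm_mul_herm_symm : herm x y * herm y x = ((‖herm x y‖ ^ 2 : ℝ) : ℂ) := by
  rw [← herm_conj x y, Complex.mul_conj, Complex.normSq_eq_norm_sq]

lemma ofReal_herm_self_re : ((herm x x).re : ℂ) = herm x x :=
  Complex.conj_eq_iff_re.1 (herm_conj x x)

lemma herm_self_re : (herm x x).re = ‖x 0‖ ^ 2 + ‖x 1‖ ^ 2 - ‖x 2‖ ^ 2 := by
  simp only [herm, Complex.star_def, Complex.mul_conj, Complex.normSq_eq_norm_sq]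
  norm_cast

lemma herm_smul_self_re : (herm (a • x) (a • x)).re = ‖a‖ ^ 2 * (herm x x).re := by
  rw [herm_smul_left, herm_smul_right, ← mul_assoc, Complex.mul_conj, Complex.re_ofReal_mul,
    Complex.normSq_eq_norm_sq]

end HermitianForm

lemma herm_eq_zero_comm {x y : Fin 3 → ℂ} : herm x y = 0 ↔ herm y x = 0 := by
  rw [← norm_eq_zero, norm_herm_comm, norm_eq_zero]

lemma herm_smul_self_neg {a : ℂ} (ha : a ≠ 0) {x : Fin 3 → ℂ} (hx : (herm x x).re < 0) :
    (herm (a • x) (a • x)).re < 0 := by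
  rw [herm_smul_self_re]
  exact mul_neg_of_pos_of_neg (by positivity) hx

lemma herm_self_pos_of_orthogonal {x s : Fin 3 → ℂ} (hx : (herm x x).re < 0)
    (hsx : herm s x = 0) (hs : s ≠ 0) : 0 < (herm s s).re := by
  rw [herm_self_re] at hx ⊢
  have triangle : ‖s 2‖ * ‖x 2‖ ≤ ‖s 0‖ * ‖x 0‖ + ‖s 1‖ * ‖x 1‖ := by
    have h : s 2 * star (x 2) = s 0 * star (x 0) + s 1 * star (x 1) := (sub_eq_zero.1 hsx).symm
    simpa only [← h, norm_mul, norm_star] using norm_add_le (s 0 * star (x 0)) (s 1 * star (x 1))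
  have cauchySchwarz : (‖s 2‖ * ‖x 2‖) ^ 2 ≤
      (‖s 0‖ ^ 2 + ‖s 1‖ ^ 2) * (‖x 0‖ ^ 2 + ‖x 1‖ ^ 2) := by
    refine (pow_le_pow_left₀ (by positivity) triangle 2).trans ?_
    linarith [sq_nonneg (‖s 0‖ * ‖x 1‖ - ‖s 1‖ * ‖x 0‖)]
  have hx2 : 0 < ‖x 2‖ ^ 2 := by nlinarith only [hx, sq_nonneg ‖x 0‖, sq_nonneg ‖x 1‖]
  by_contra! hneg
  have h01 : ‖s 0‖ ^ 2 + ‖s 1‖ ^ 2 = 0 := by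
    refine le_antisymm ?_ (by positivity)
    nlinarith
  have h2 : ‖s 2‖ ^ 2 = 0 := by
    refine le_antisymm ?_ (by positivity)
    rw [h01, zero_mul, mul_pow] at cauchySchwarz
    exact nonpos_of_mul_nonpos_left cauchySchwarz hx2
  obtain ⟨h0, h1⟩ := (add_eq_zero_iff_of_nonneg (sq_nonneg _) (sq_nonneg _)).1 h01
  apply hs
  ext i
  rw [Pi.zero_apply, ← norm_eq_zero, ← sq_eq_zero_iff]
  fin_cases i <;> assumption

lemma herm_self_mul_le_norm_sq {x : Fin 3 → ℂ} (hx : (herm x x).re < 0) (y : Fin 3 → ℂ) :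
    (herm x x).re * (herm y y).re ≤ ‖herm x y‖ ^ 2 := by
  set s := herm x x • y - herm y x • x
  have hsx : herm s x = 0 := by
    simp only [herm_sub_left, herm_smul_left, s]
    ring
  have hs : 0 ≤ (herm s s).re := by
    rcases eq_or_ne s 0 with h0 | h0
    · simp [h0]
    · exact (herm_self_pos_of_orthogonal hx hsx h0).le
  have hss : (herm s s).re = (herm x x).re * ((herm x x).re * (herm y y).re - ‖herm x y‖ ^ 2) := by
    rw [← Complex.ofReal_inj]
    push_cast
    simp only [ofReal_herm_self_re, ← Complex.ofReal_pow, ← herm_mul_herm_symm]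
    simp only [herm_sub_right, herm_smul_right, herm_conj, herm_sub_left, herm_smul_left, s]
    ring
  nlinarith

/-- A vector spanning the centre of the ball `H²_ℂ`. -/
def ballCentre : Fin 3 → ℂ := ![0, 0, 1]

lemma ballCentre_neg : (herm ballCentre ballCentre).re < 0 := by simp [herm, ballCentre]

/-- The orthogonal projection along `c`, meaningful when `herm c c ≠ 0`. For a positive vector `c`
it retracts the negative vectors onto those of the complex geodesic with polar vector `c`. -/
noncomputable def polarProj (c z : Fin 3 → ℂ) : Fin 3 → ℂ :=
  z - (herm z c / herm c c) • c

section PolarProj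

variable {c : Fin 3 → ℂ}

lemma herm_polarProj (hc : herm c c ≠ 0) (z : Fin 3 → ℂ) : herm c (polarProj c z) = 0 := by
  simp [polarProj, hc]

lemma herm_polarProj_of_orthogonal {x : Fin 3 → ℂ} (hxc : herm x c = 0) (z : Fin 3 → ℂ) :
    herm x (polarProj c z) = herm x z := by
  simp [polarProj, hxc]

lemma herm_polarProj_polarProj (hc : herm c c ≠ 0) (z : Fin 3 → ℂ) :
    herm (polarProj c z) (polarProj c z) = herm z z - ‖herm z c‖ ^ 2 / herm c c := by
  rw [herm_polarProj_of_orthogonal (herm_eq_zero_comm.1 (herm_polarProj hc z)), polarProj,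
    herm_sub_left, herm_smul_left, div_mul_eq_mul_div, herm_mul_herm_symm, Complex.ofReal_pow]

lemma polarProj_neg (hc : 0 < (herm c c).re) {z : Fin 3 → ℂ} (hz : (herm z z).re < 0) :
    (herm (polarProj c z) (polarProj c z)).re < 0 := by
  have hc0 : herm c c ≠ 0 := fun h => by simp [h] at hc
  rw [herm_polarProj_polarProj hc0, ← ofReal_herm_self_re c]
  have : 0 ≤ ‖herm z c‖ ^ 2 / (herm c c).re := by positivity
  norm_cast
  rw [Complex.sub_re, Complex.ofReal_re]
  linarith

end PolarProj

lemma exists_neg_orthogonal {c : Fin 3 → ℂ} (hc : 0 < (herm c c).re) :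
    ∃ x, (herm x x).re < 0 ∧ herm c x = 0 :=
  ⟨polarProj c ballCentre, polarProj_neg hc ballCentre_neg,
    herm_polarProj (fun h => by simp [h] at hc) _⟩

lemma exists_neg_orthogonal_pair {c d : Fin 3 → ℂ} (hd : 0 < (herm d d).re)
    (hcd : 0 < (herm (polarProj d c) (polarProj d c)).re) :
    ∃ x, (herm x x).re < 0 ∧ herm c x = 0 ∧ herm d x = 0 := by
  have hd0 : herm d d ≠ 0 := fun h => by simp [h] at hd
  obtain ⟨o, ho, hdo⟩ := exists_neg_orthogonal hd
  set f := polarProj d c with hf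
  set x := polarProj f o
  have hdx : herm d x = 0 := by
    rw [herm_polarProj_of_orthogonal (herm_polarProj hd0 c), hdo]
  have hfx : herm f x = 0 := herm_polarProj (fun h => by simp [h] at hcd) o
  refine ⟨x, polarProj_neg hcd ho, ?_, hdx⟩
  simpa [hf, polarProj, hdx] using hfx

/-! ### The distance between complex geodesics -/

lemma exists_HC2_vec_eq_smul {x : Fin 3 → ℂ} (hx : (herm x x).re < 0) :
    ∃ p : HC2, ∃ a : ℂ, a ≠ 0 ∧ p.vec = a • x := by
  have hx0 : x ≠ 0 := by
    rintro rfl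
    simp at hx
  obtain ⟨a, ha⟩ := Projectivization.exists_smul_eq_mk_rep ℂ x hx0
  refine ⟨⟨Projectivization.mk ℂ x hx0, ?_⟩, a, a.ne_zero, ha.symm⟩
  rw [← ha]
  exact herm_smul_self_neg a.ne_zero hx

lemma exists_mem_complexGeodesic {c x : Fin 3 → ℂ} (hx : (herm x x).re < 0) (hcx : herm c x = 0) :
    ∃ p ∈ complexGeodesic c, ∃ a : ℂ, a ≠ 0 ∧ p.vec = a • x := by
  obtain ⟨p, a, ha, hp⟩ := exists_HC2_vec_eq_smul hx
  exact ⟨p, by simp [complexGeodesic, hp, hcx], a, ha, hp⟩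

/-- For negative vectors, the squared hyperbolic cosine of half the Bergman distance. -/
noncomputable def crossRatio (x y : Fin 3 → ℂ) : ℝ :=
  ‖herm x y‖ ^ 2 / ((herm x x).re * (herm y y).re)

lemma bergmanDist_eq (p q : HC2) :
    bergmanDist p q = 2 * Real.arcosh (Real.sqrt (crossRatio p.vec q.vec)) := by
  rw [bergmanDist, crossRatio, herm_mul_herm_symm, ← ofReal_herm_self_re p.vec,
    ← ofReal_herm_self_re q.vec]
  norm_cast

lemma crossRatio_smul {a b : ℂ} (ha : a ≠ 0) (hb : b ≠ 0) (x y : Fin 3 → ℂ) :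
    crossRatio (a • x) (b • y) = crossRatio x y := by
  have hab : ‖a‖ ^ 2 * ‖b‖ ^ 2 ≠ 0 := by positivity
  rw [crossRatio, crossRatio, herm_smul_self_re, herm_smul_self_re, mul_mul_mul_comm,
    ← mul_div_mul_left (‖herm x y‖ ^ 2) _ hab]
  simp only [herm_smul_left, herm_smul_right, norm_mul, Complex.norm_conj]
  ring

section Unit

variable {c d : Fin 3 → ℂ} (hc : herm c c = 1) (hd : herm d d = 1)

include hc hd

lemma herm_polarProj_polarProj_unit :
    (herm (polarProj d c) (polarProj d c)).re = 1 - ‖herm c d‖ ^ 2 := by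
  rw [herm_polarProj_polarProj (by simp [hd]), hc, hd]
  norm_cast
  simp

lemma one_le_norm_herm_of_disjoint (h : Disjoint (complexGeodesic c) (complexGeodesic d)) :
    1 ≤ ‖herm c d‖ := by
  by_contra! hlt
  have hcd : 0 < (herm (polarProj d c) (polarProj d c)).re := by
    rw [herm_polarProj_polarProj_unit hc hd]
    nlinarith [norm_nonneg (herm c d)]
  obtain ⟨x, hx, hcx, hdx⟩ := exists_neg_orthogonal_pair (by simp [hd]) hcd
  obtain ⟨p, hpc, a, -, hp⟩ := exists_mem_complexGeodesic hx hcx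
  exact Set.disjoint_left.1 h hpc (by simp [complexGeodesic, hp, hdx])

lemma sq_norm_herm_le_crossRatio {x y : Fin 3 → ℂ} (hx : (herm x x).re < 0)
    (hy : (herm y y).re < 0) (hcx : herm c x = 0) (hdy : herm d y = 0) :
    ‖herm c d‖ ^ 2 ≤ crossRatio x y := by
  have polar_bound : (herm y y).re * (1 - ‖herm c d‖ ^ 2) ≤ ‖herm y c‖ ^ 2 := by
    have h := herm_self_mul_le_norm_sq hy (polarProj d c)
    rwa [herm_polarProj_polarProj_unit hc hd,
      herm_polarProj_of_orthogonal (herm_eq_zero_comm.1 hdy)] at h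
  have proj_bound : (herm x x).re * ((herm y y).re - ‖herm y c‖ ^ 2) ≤ ‖herm x y‖ ^ 2 := by
    have h := herm_self_mul_le_norm_sq hx (polarProj c y)
    rw [herm_polarProj_polarProj (by simp [hc]),
      herm_polarProj_of_orthogonal (herm_eq_zero_comm.1 hcx), hc] at h
    simpa [← Complex.ofReal_pow] using h
  rw [crossRatio, le_div_iff₀ (mul_pos_of_neg_of_neg hx hy)]
  nlinarith

lemma exists_neg_orthogonal_norm_sq_lt_of_parallel (hcd : ‖herm c d‖ = 1) {s : ℝ} (hs : 0 < s) :
    ∃ y, (herm y y).re < 0 ∧ herm d y = 0 ∧ ‖herm y c‖ ^ 2 < s * -(herm y y).re := by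
  obtain ⟨o, ho, hdo⟩ := exists_neg_orthogonal (c := d) (by simp [hd])
  set f := polarProj d c
  have hdf : herm d f = 0 := herm_polarProj (by simp [hd]) c
  have herm_f : ∀ y, herm d y = 0 → herm y c = herm y f := fun y hy =>
    (herm_polarProj_of_orthogonal (herm_eq_zero_comm.1 hy) c).symm
  rcases eq_or_ne (herm o f) 0 with h0 | h0
  · refine ⟨o, ho, hdo, ?_⟩
    rw [herm_f o hdo, h0]
    simpa using mul_neg_of_pos_of_neg hs ho
  · set p := -(s / herm o f) • o with hp
    have hpp : (herm p p).re < 0 := herm_smul_self_neg (by simp [h0, hs.ne']) ho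
    have hpf : herm p f = -s := by simp [hp, h0]
    have hfp : herm f p = -s := by rw [← herm_conj, hpf]; simp
    have hff : herm f f = 0 := by
      rw [← ofReal_herm_self_re, herm_polarProj_polarProj_unit hc hd, hcd]; simp
    have hdy : herm d (f + p) = 0 := by simp [hp, hdf, hdo]
    have hyy : (herm (f + p) (f + p)).re = (herm p p).re - 2 * s := by
      simp only [herm_add_right, herm_add_left, hff, hpf, zero_add, hfp, Complex.add_re,
        Complex.neg_re, Complex.ofReal_re]
      ring
    refine ⟨f + p, by linarith, hdy, ?_⟩
    rw [herm_f _ hdy, hyy, herm_add_left, hff, hpf]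
    simp only [zero_add, norm_neg, Complex.norm_real, Real.norm_eq_abs, sq_abs]
    nlinarith

lemma exists_neg_orthogonal_norm_sq_lt (hcd : 1 ≤ ‖herm c d‖) {s : ℝ}
    (hs : ‖herm c d‖ ^ 2 - 1 < s) :
    ∃ y, (herm y y).re < 0 ∧ herm d y = 0 ∧ ‖herm y c‖ ^ 2 < s * -(herm y y).re := by
  rcases hcd.eq_or_lt with h1 | h1
  · exact exists_neg_orthogonal_norm_sq_lt_of_parallel hc hd h1.symm (by simpa [← h1] using hs)
  · have hd0 : herm d d ≠ 0 := by simp [hd]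
    have hpos : 0 < ‖herm c d‖ ^ 2 - 1 := by nlinarith
    have hneg : (herm (polarProj d c) (polarProj d c)).re < 0 := by
      rw [herm_polarProj_polarProj_unit hc hd]; linarith
    have hpc : ‖herm (polarProj d c) c‖ = ‖herm c d‖ ^ 2 - 1 := by
      rw [← herm_polarProj_of_orthogonal (herm_eq_zero_comm.1 (herm_polarProj hd0 c)) c,
        ← ofReal_herm_self_re, Complex.norm_real, Real.norm_of_nonpos hneg.le,
        herm_polarProj_polarProj_unit hc hd]
      ring
    refine ⟨polarProj d c, hneg, herm_polarProj hd0 c, ?_⟩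
    rw [hpc, herm_polarProj_polarProj_unit hc hd, neg_sub, sq]
    exact mul_lt_mul_of_pos_right hs hpos

lemma exists_crossRatio_lt (hcd : 1 ≤ ‖herm c d‖) {b : ℝ} (hb : ‖herm c d‖ ^ 2 < b) :
    ∃ x y, (herm x x).re < 0 ∧ (herm y y).re < 0 ∧ herm c x = 0 ∧ herm d y = 0 ∧
      crossRatio x y < b := by
  obtain ⟨y, hy, hdy, hyc⟩ :=
    exists_neg_orthogonal_norm_sq_lt hc hd hcd (sub_lt_sub_right hb 1)
  have hc0 : herm c c ≠ 0 := by simp [hc]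
  have hcx := herm_polarProj hc0 y
  have hx := polarProj_neg (c := c) (by simp [hc]) hy
  have hxy : herm (polarProj c y) y = herm (polarProj c y) (polarProj c y) :=
    (herm_polarProj_of_orthogonal (herm_eq_zero_comm.1 hcx) y).symm
  have hxx : (herm (polarProj c y) (polarProj c y)).re = (herm y y).re - ‖herm y c‖ ^ 2 := by
    rw [herm_polarProj_polarProj hc0, hc]
    simp [← Complex.ofReal_pow]
  refine ⟨polarProj c y, y, hx, hy, hcx, hdy, ?_⟩
  rw [crossRatio, hxy, ← ofReal_herm_self_re, Complex.norm_real, Real.norm_eq_abs, sq_abs,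
    Complex.ofReal_re, sq, mul_div_mul_left _ _ hx.ne, div_lt_iff_of_neg hy]
  linarith

theorem setDist_complexGeodesic (hcd : 1 ≤ ‖herm c d‖) :
    setDist (complexGeodesic c) (complexGeodesic d) = 2 * Real.arcosh ‖herm c d‖ := by
  refine csInf_eq_of_forall_ge_of_forall_gt_exists_lt ?_ ?_ ?_
  · obtain ⟨x, hx, hcx⟩ := exists_neg_orthogonal (c := c) (by simp [hc])
    obtain ⟨y, hy, hdy⟩ := exists_neg_orthogonal (c := d) (by simp [hd])
    obtain ⟨p, hp, -⟩ := exists_mem_complexGeodesic hx hcx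
    obtain ⟨q, hq, -⟩ := exists_mem_complexGeodesic hy hdy
    exact ⟨_, p, hp, q, hq, rfl⟩
  · rintro _ ⟨p, hp, q, hq, rfl⟩
    have h := Real.le_sqrt_of_sq_le
      (sq_norm_herm_le_crossRatio hc hd (x := p.vec) (y := q.vec) p.2 q.2 hp hq)
    rw [bergmanDist_eq]
    linarith [(Real.arcosh_le_arcosh (by linarith) (by linarith)).2 h]
  · intro b hb
    have hcosh : ‖herm c d‖ < Real.cosh (b / 2) := by
      rw [← Real.cosh_arcosh hcd, Real.cosh_lt_cosh, abs_of_nonneg (Real.arcosh_nonneg hcd)]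
      exact lt_of_lt_of_le (by linarith) (le_abs_self _)
    obtain ⟨x, y, hx, hy, hcx, hdy, hxy⟩ := exists_crossRatio_lt hc hd hcd
      (pow_lt_pow_left₀ hcosh (norm_nonneg _) two_ne_zero)
    obtain ⟨p, hp, u, hu, hpx⟩ := exists_mem_complexGeodesic hx hcx
    obtain ⟨q, hq, v, hv, hqy⟩ := exists_mem_complexGeodesic hy hdy
    refine ⟨_, ⟨p, hp, q, hq, rfl⟩, ?_⟩
    have hsqrt : Real.sqrt (crossRatio x y) < Real.cosh (b / 2) :=
      (Real.sqrt_lt' (Real.cosh_pos _)).2 hxy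
    have hone : 1 ≤ Real.sqrt (crossRatio x y) :=
      hcd.trans (Real.le_sqrt_of_sq_le (sq_norm_herm_le_crossRatio hc hd hx hy hcx hdy))
    rw [bergmanDist_eq, hpx, hqy, crossRatio_smul hu hv]
    have h := (Real.arcosh_lt_arcosh (by linarith) (Real.cosh_pos _)).2 hsqrt
    have hb0 : 0 ≤ b / 2 := by linarith [Real.arcosh_nonneg hcd]
    rw [Real.arcosh_cosh hb0] at h
    linarith

theorem cosh_half_setDist (h : Disjoint (complexGeodesic c) (complexGeodesic d)) :
    Real.cosh (setDist (complexGeodesic c) (complexGeodesic d) / 2) = ‖herm c d‖ := by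
  have hcd := one_le_norm_herm_of_disjoint hc hd h
  rw [setDist_complexGeodesic hc hd hcd, mul_div_cancel_left₀ _ two_ne_zero, Real.cosh_arcosh hcd]

end Unit

lemma ne_smul_of_disjoint {c d : Fin 3 → ℂ} (hc : 0 < (herm c c).re)
    (h : Disjoint (complexGeodesic c) (complexGeodesic d)) (a : ℂ) : d ≠ a • c := by
  rintro rfl
  obtain ⟨x, hx, hcx⟩ := exists_neg_orthogonal hc
  obtain ⟨p, hpc, b, -, hp⟩ := exists_mem_complexGeodesic hx hcx
  exact Set.disjoint_left.1 h hpc (by simp [complexGeodesic, hp, hcx])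

/-! ### Eisenstein integers -/

/-- The primitive third root of unity `(-1 + i √3) / 2`. -/
noncomputable def eisOmega : ℂ := ⟨-1 / 2, Real.sqrt 3 / 2⟩

lemma eisOmega_sq : eisOmega ^ 2 = -1 - eisOmega := by
  have h3 : Real.sqrt 3 * Real.sqrt 3 = 3 := Real.mul_self_sqrt (by norm_num)
  apply Complex.ext
  · simp only [eisOmega, sq, Complex.mul_re, Complex.sub_re, Complex.neg_re, Complex.one_re]
    linarith
  · simp only [eisOmega, sq, Complex.mul_im, Complex.sub_im, Complex.neg_im, Complex.one_im]
    ring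

lemma conj_eisOmega : conj eisOmega = -1 - eisOmega := by
  apply Complex.ext
  · simp only [eisOmega, Complex.conj_re, Complex.sub_re, Complex.neg_re, Complex.one_re]
    norm_num
  · simp [eisOmega]

lemma eisOmega_cube : eisOmega ^ 3 = 1 := by
  linear_combination (eisOmega - 1) * eisOmega_sq

lemma norm_eisOmega : ‖eisOmega‖ = 1 :=
  Complex.norm_eq_one_of_pow_eq_one eisOmega_cube three_ne_zero

lemma eq_of_cube_eq_one {u : ℂ} (hu : u ^ 3 = 1) :
    u = 1 ∨ u = eisOmega ∨ u = eisOmega ^ 2 := by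
  have h : (u - 1) * ((u - eisOmega) * (u - eisOmega ^ 2)) = 0 := by
    linear_combination hu - eisOmega_cube + (u * eisOmega - u ^ 2) * eisOmega_sq
  simpa only [mul_eq_zero, sub_eq_zero] using h

lemma norm_sq_add_mul_eisOmega (a b : ℝ) : ‖a + b * eisOmega‖ ^ 2 = a ^ 2 - a * b + b ^ 2 := by
  have h3 : Real.sqrt 3 * Real.sqrt 3 = 3 := Real.mul_self_sqrt (by norm_num)
  rw [← Complex.normSq_eq_norm_sq, Complex.normSq_apply]
  simp only [eisOmega, Complex.add_re, Complex.ofReal_re, Complex.mul_re, Complex.ofReal_im,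
    Complex.add_im, Complex.mul_im]
  linear_combination (b ^ 2 / 4) * h3

lemma norm_sq_one_sub_eisOmega : ‖1 - eisOmega‖ ^ 2 = 3 := by
  have h := norm_sq_add_mul_eisOmega 1 (-1)
  rw [Complex.ofReal_one, Complex.ofReal_neg, Complex.ofReal_one, neg_one_mul,
    ← sub_eq_add_neg] at h
  rw [h]
  norm_num

/-- The ring of Eisenstein integers. -/
noncomputable def eisenstein : Subring ℂ where
  carrier := {z | ∃ a b : ℤ, z = a + b * eisOmega}
  zero_mem' := ⟨0, 0, by simp⟩
  one_mem' := ⟨1, 0, by simp⟩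
  add_mem' := by
    rintro _ _ ⟨a, b, rfl⟩ ⟨a', b', rfl⟩
    exact ⟨a + a', b + b', by push_cast; ring⟩
  neg_mem' := by
    rintro _ ⟨a, b, rfl⟩
    exact ⟨-a, -b, by push_cast; ring⟩
  mul_mem' := by
    rintro _ _ ⟨a, b, rfl⟩ ⟨a', b', rfl⟩
    refine ⟨a * a' - b * b', a * b' + b * a' - b * b', ?_⟩
    push_cast
    linear_combination (b : ℂ) * b' * eisOmega_sq

lemma eisOmega_mem_eisenstein : eisOmega ∈ eisenstein := ⟨0, 1, by simp⟩

lemma conj_mem_eisenstein {z : ℂ} (hz : z ∈ eisenstein) : conj z ∈ eisenstein := by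
  obtain ⟨a, b, rfl⟩ := hz
  refine ⟨a - b, -b, ?_⟩
  simp only [map_add, map_mul, map_intCast, conj_eisOmega]
  push_cast
  ring

lemma mem_eisenstein_of_cube_eq_one {u : ℂ} (hu : u ^ 3 = 1) : u ∈ eisenstein := by
  rcases eq_of_cube_eq_one hu with rfl | rfl | rfl
  · exact one_mem _
  · exact eisOmega_mem_eisenstein
  · exact pow_mem eisOmega_mem_eisenstein 2

lemma one_le_norm_of_mem_eisenstein {z : ℂ} (hz : z ∈ eisenstein) (h0 : z ≠ 0) : 1 ≤ ‖z‖ := by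
  obtain ⟨a, b, rfl⟩ := hz
  have hnorm : ‖(a : ℂ) + b * eisOmega‖ ^ 2 = ((a ^ 2 - a * b + b ^ 2 : ℤ) : ℝ) := by
    simpa using norm_sq_add_mul_eisOmega a b
  have hpos : 0 < ‖(a : ℂ) + b * eisOmega‖ ^ 2 := by positivity
  rw [hnorm] at hpos
  rw [← one_le_sq_iff₀ (norm_nonneg _), hnorm]
  exact_mod_cast Int.add_one_le_iff.2 (show 0 < a ^ 2 - a * b + b ^ 2 by exact_mod_cast hpos)

lemma eq_zero_of_mem_eisenstein {z : ℂ} (hz : z ∈ eisenstein) (h : ‖z‖ < 1) : z = 0 := by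
  by_contra h0
  exact h.not_ge (one_le_norm_of_mem_eisenstein hz h0)

/-- The ideal of the Eisenstein integers generated by the prime `1 - ω` above `3`. -/
noncomputable def eisensteinPrime : AddSubgroup ℂ :=
  eisenstein.toAddSubgroup.map (AddMonoidHom.mulLeft (1 - eisOmega))

lemma mem_eisensteinPrime {z : ℂ} :
    z ∈ eisensteinPrime ↔ ∃ n ∈ eisenstein, (1 - eisOmega) * n = z := Iff.rfl

lemma mul_mem_eisensteinPrime {a b : ℂ} (ha : a ∈ eisenstein) (hb : b ∈ eisensteinPrime) :
    a * b ∈ eisensteinPrime := by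
  obtain ⟨n, hn, rfl⟩ := mem_eisensteinPrime.1 hb
  exact mem_eisensteinPrime.2 ⟨a * n, mul_mem ha hn, by ring⟩

lemma mem_eisenstein_of_mem_eisensteinPrime {b : ℂ} (hb : b ∈ eisensteinPrime) :
    b ∈ eisenstein := by
  obtain ⟨n, hn, rfl⟩ := mem_eisensteinPrime.1 hb
  exact mul_mem (sub_mem (one_mem _) eisOmega_mem_eisenstein) hn

lemma one_sub_mem_eisensteinPrime {u : ℂ} (hu : u ^ 3 = 1) : 1 - u ∈ eisensteinPrime := by
  rcases eq_of_cube_eq_one hu with rfl | rfl | rfl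
  · exact mem_eisensteinPrime.2 ⟨0, zero_mem _, by ring⟩
  · exact mem_eisensteinPrime.2 ⟨1, one_mem _, by ring⟩
  · exact mem_eisensteinPrime.2
      ⟨1 + eisOmega, add_mem (one_mem _) eisOmega_mem_eisenstein, by ring⟩

/-- The closed Voronoi cell of `0` in the lattice of Eisenstein integers: a regular hexagon. -/
def eisensteinCell : Set ℂ :=
  {w | ∀ n ∈ eisenstein, ‖w‖ ≤ ‖w - n‖}

lemma three_mul_norm_sq_le_one_of_mem_eisensteinCell {w : ℂ} (hw : w ∈ eisensteinCell) :
    3 * ‖w‖ ^ 2 ≤ 1 := by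
  have h3 : Real.sqrt 3 * Real.sqrt 3 = 3 := Real.mul_self_sqrt (by norm_num)
  have half_plane : ∀ n ∈ eisenstein, 2 * (w * conj n).re ≤ ‖n‖ ^ 2 := by
    intro n hn
    have h := pow_le_pow_left₀ (norm_nonneg _) (hw n hn) 2
    rw [← Complex.normSq_eq_norm_sq (w - n), Complex.normSq_sub] at h
    simp only [Complex.normSq_eq_norm_sq] at h
    linarith
  have hexagon : ∀ n ∈ eisenstein, ‖n‖ = 1 → |(w * conj n).re| ≤ 1 / 2 := by
    intro n hn h1
    have hpos := half_plane n hn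
    have hneg := half_plane (-n) (neg_mem hn)
    simp only [map_neg, mul_neg, Complex.neg_re, norm_neg, h1] at hpos hneg
    exact abs_le.2 ⟨by linarith, by linarith⟩
  have h₀ := hexagon 1 (one_mem _) norm_one
  have h₁ := hexagon eisOmega eisOmega_mem_eisenstein norm_eisOmega
  have h₂ := hexagon (eisOmega ^ 2) (pow_mem eisOmega_mem_eisenstein 2) (by simp [norm_eisOmega])
  rw [eisOmega_sq] at h₂
  simp only [eisOmega, map_one, mul_one, map_sub, map_neg, Complex.mul_re, Complex.conj_re,
    Complex.conj_im, Complex.sub_re, Complex.sub_im, Complex.neg_re, Complex.neg_im,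
    Complex.one_re, Complex.one_im, abs_le] at h₀ h₁ h₂
  have hS : |Real.sqrt 3 * w.im| ≤ 1 - |w.re| := by
    rcases abs_cases w.re with ⟨h, -⟩ | ⟨h, -⟩ <;> rw [h, abs_le] <;> constructor <;> linarith
  have hS2 := pow_le_pow_left₀ (abs_nonneg _) hS 2
  rw [sq_abs] at hS2
  have hre : |w.re| ≤ 1 / 2 := abs_le.2 h₀
  rw [← Complex.normSq_eq_norm_sq, Complex.normSq_apply]
  nlinarith [abs_nonneg w.re, sq_abs w.re]

lemma sq_sub_mul_add_sq_sub_nonneg (x y : ℤ) : 0 ≤ x ^ 2 - x * y + y ^ 2 - x := by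
  by_contra! h
  nlinarith [sq_nonneg (2 * x - y - 1), sq_nonneg (3 * y - 1)]

lemma mem_eisensteinCell_of_re_eq_half {w : ℂ} (hre : w.re = 1 / 2) (hw : 3 * ‖w‖ ^ 2 ≤ 1) :
    w ∈ eisensteinCell := by
  rintro _ ⟨x, y, rfl⟩
  have h3 : Real.sqrt 3 * Real.sqrt 3 = 3 := Real.mul_self_sqrt (by norm_num)
  rw [← sq_le_sq₀ (norm_nonneg _) (norm_nonneg _)]
  simp only [← Complex.normSq_eq_norm_sq] at hw ⊢
  have hexp : Complex.normSq (w - (x + y * eisOmega)) =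
      Complex.normSq w + ((x : ℝ) ^ 2 - x * y + y ^ 2 - x + y / 2 - (Real.sqrt 3 * w.im) * y) := by
    simp only [Complex.normSq_apply, eisOmega, Complex.sub_re, Complex.add_re, Complex.mul_re,
      Complex.intCast_re, Complex.intCast_im, Complex.sub_im, Complex.add_im, Complex.mul_im, hre]
    linear_combination ((y : ℝ) ^ 2 / 4) * h3
  obtain ⟨hl, hu⟩ : -(1 / 2) ≤ Real.sqrt 3 * w.im ∧ Real.sqrt 3 * w.im ≤ 1 / 2 := by
    refine abs_le.1 (abs_le_of_sq_le_sq ?_ (by norm_num))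
    rw [Complex.normSq_apply, hre] at hw
    nlinarith
  suffices 0 ≤ (x : ℝ) ^ 2 - x * y + y ^ 2 - x + y / 2 - (Real.sqrt 3 * w.im) * y by linarith
  rcases le_total y 0 with hy | hy
  · have hlattice := sq_sub_mul_add_sq_sub_nonneg (x - y) (-y)
    rify at hlattice hy
    nlinarith
  · have hlattice := sq_sub_mul_add_sq_sub_nonneg x y
    rify at hlattice hy
    nlinarith

lemma div_sub_mem_eisensteinCell {x y : ℂ} (hx : x ≠ 0) (hxy : ‖x‖ = ‖y‖)
    (hre : (x * conj y).re ≤ -‖x‖ ^ 2 / 2) : x / (x - y) ∈ eisensteinCell := by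
  have hx0 : 0 < ‖x‖ ^ 2 := by positivity
  have hsub : ‖x - y‖ ^ 2 = 2 * (‖x‖ ^ 2 - (x * conj y).re) := by
    rw [← Complex.normSq_eq_norm_sq, Complex.normSq_sub, Complex.normSq_eq_norm_sq,
      Complex.normSq_eq_norm_sq, ← hxy]
    ring
  have hsub0 : 0 < ‖x - y‖ ^ 2 := by rw [hsub]; linarith
  apply mem_eisensteinCell_of_re_eq_half
  · rw [div_eq_mul_inv, Complex.inv_def, ← mul_assoc, Complex.re_mul_ofReal, map_sub, mul_sub,
      Complex.mul_conj, Complex.sub_re, Complex.ofReal_re, Complex.normSq_eq_norm_sq,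
      Complex.normSq_eq_norm_sq, ← div_eq_mul_inv, div_eq_iff hsub0.ne']
    linarith
  · rw [norm_div, div_pow, ← mul_div_assoc, div_le_one hsub0]
    linarith

lemma three_mul_norm_sq_le {w u b : ℂ} (hw : w ∈ eisensteinCell) (hu : u ^ 3 = 1)
    (hb : b ∈ eisensteinPrime) (hne : u ≠ 1 ∨ b ≠ 0) :
    3 * ‖w‖ ^ 2 ≤ ‖b + u * w - w‖ ^ 2 := by
  obtain ⟨n, hn, rfl⟩ := mem_eisensteinPrime.1 hb
  suffices ∃ z, ‖w‖ ≤ ‖z‖ ∧ (1 - eisOmega) * n + u * w - w = (1 - eisOmega) * z by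
    obtain ⟨z, hz, h⟩ := this
    rw [h, norm_mul, mul_pow, norm_sq_one_sub_eisOmega]
    gcongr
  rcases eq_of_cube_eq_one hu with rfl | rfl | rfl
  · have hn0 : n ≠ 0 := by
      rintro rfl
      simp at hne
    refine ⟨n, ?_, by ring⟩
    nlinarith [one_le_norm_of_mem_eisenstein hn hn0, norm_nonneg w,
      three_mul_norm_sq_le_one_of_mem_eisensteinCell hw]
  · refine ⟨n - w, ?_, by ring⟩
    rw [norm_sub_rev]
    exact hw n hn
  · refine ⟨eisOmega ^ 2 * (w - -(eisOmega * n)), ?_, ?_⟩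
    · rw [norm_mul, norm_pow, norm_eisOmega, one_pow, one_mul]
      exact hw _ (neg_mem (mul_mem eisOmega_mem_eisenstein hn))
    · linear_combination (w - n * (1 - eisOmega)) * eisOmega_cube

/-! ### Alternating words -/

/-- The products `J p₀ J p₁ ⋯ J pₖ` with `pᵢ ∈ P`, all but the last different from `1`: the words
to which the ping-pong argument applies. -/
inductive IsAlternating {G : Type*} [Group G] (P : Subgroup G) (J : G) : G → Prop
  | base {p : G} (hp : p ∈ P) : IsAlternating P J (J * p)
  | step {p g : G} (hp : p ∈ P) (hp1 : p ≠ 1) (hg : IsAlternating P J g) :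
      IsAlternating P J (J * (p * g))

lemma mem_or_eq_mul_isAlternating_of_mem_closure {G : Type*} [Group G] {P : Subgroup G} {J g : G}
    (hJ : J * J = 1) (hg : g ∈ Subgroup.closure ((P : Set G) ∪ {J})) :
    g ∈ P ∨ ∃ p ∈ P, ∃ g', IsAlternating P J g' ∧ g = p * g' := by
  have mul_P {p x : G} (hp : p ∈ P) (hx : x ∈ P ∨ ∃ p ∈ P, ∃ g, IsAlternating P J g ∧ x = p * g) :
      p * x ∈ P ∨ ∃ p' ∈ P, ∃ g, IsAlternating P J g ∧ p * x = p' * g := by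
    obtain hx | ⟨p', hp', g, hg, rfl⟩ := hx
    · exact .inl (mul_mem hp hx)
    · exact .inr ⟨p * p', mul_mem hp hp', g, hg, (mul_assoc _ _ _).symm⟩
  have mul_J {x : G} (hx : x ∈ P ∨ ∃ p ∈ P, ∃ g, IsAlternating P J g ∧ x = p * g) :
      J * x ∈ P ∨ ∃ p ∈ P, ∃ g, IsAlternating P J g ∧ J * x = p * g := by
    obtain hx | ⟨p, hp, g, hg, rfl⟩ := hx
    · exact .inr ⟨1, one_mem _, _, .base hx, (one_mul _).symm⟩
    obtain rfl | hp1 := eq_or_ne p 1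
    · rw [one_mul]
      cases hg with
      | base hp' => exact .inl (by rwa [← mul_assoc, hJ, one_mul])
      | step hp' _ hg' => exact .inr ⟨_, hp', _, hg', by rw [← mul_assoc, hJ, one_mul]⟩
    · exact .inr ⟨1, one_mem _, _, .step hp hp1 hg, (one_mul _).symm⟩
  induction hg using Subgroup.closure_induction_left with
  | one => exact .inl (one_mem _)
  | mul_left a ha b hb ih =>
    obtain ha | rfl := ha
    · exact mul_P ha ih
    · exact mul_J ih
  | inv_mul_cancel a ha b hb ih =>
    obtain ha | rfl := ha
    · exact mul_P (inv_mem ha) ih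
    · rw [inv_eq_of_mul_eq_one_left hJ]
      exact mul_J ih

/-! ### Heisenberg frames and the stabiliser of a boundary point -/

lemma u21_smul_def (A : U21) (z : Fin 3 → ℂ) : A • z = A.1.1 *ᵥ z := rfl

@[simp]
lemma herm_u21_smul (A : U21) (z w : Fin 3 → ℂ) : herm (A • z) (A • w) = herm z w := A.2 z w

lemma herm_u21_inv_smul (A : U21) (z w : Fin 3 → ℂ) : herm (A⁻¹ • z) w = herm z (A • w) := by
  rw [← herm_u21_smul A, smul_inv_smul]

lemma u21_ext {A B : U21} (h : ∀ z : Fin 3 → ℂ, A • z = B • z) : A = B :=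
  Subtype.ext (Units.ext (Matrix.ext_of_mulVec_single fun i => h (Pi.single i 1)))

/-- A hyperbolic pair of null vectors `v, q` together with a unit vector `c` orthogonal to it: a
choice of Heisenberg coordinates on the boundary of `H²_ℂ` with point at infinity `q`. -/
structure HeisenbergFrame where
  /-- The null vector representing the origin. -/
  v : Fin 3 → ℂ
  /-- The unit vector along the horizontal direction. -/
  c : Fin 3 → ℂ
  /-- The null vector representing the point at infinity. -/
  q : Fin 3 → ℂ
  vv : herm v v = 0
  vc : herm v c = 0
  vq : herm v q = 1
  cc : herm c c = 1
  cq : herm c q = 0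
  qq : herm q q = 0

lemma exists_heisenbergFrame {c q : Fin 3 → ℂ} (hc : herm c c = 1) (hcq : herm c q = 0)
    (hq : herm q q = 0) (hq0 : q ≠ 0) : ∃ F : HeisenbergFrame, F.c = c ∧ F.q = q := by
  obtain ⟨o, ho, hco⟩ := exists_neg_orthogonal (c := c) (by simp [hc])
  have hoq : herm o q ≠ 0 := fun h => by
    simpa [hq] using herm_self_pos_of_orthogonal ho (herm_eq_zero_comm.1 h) hq0
  set x := (herm o q)⁻¹ • o with hx
  have hxc : herm x c = 0 := by simp [hx, herm_eq_zero_comm.1 hco]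
  have hxq : herm x q = 1 := by simp [hx, hoq]
  have hqx : herm q x = 1 := by rw [← herm_conj, hxq, map_one]
  have hqc : herm q c = 0 := herm_eq_zero_comm.1 hcq
  refine ⟨⟨x - (herm x x / 2) • q, c, q, ?_, ?_, ?_, hc, hcq, hq⟩, rfl, rfl⟩
  · simp only [herm_sub_right, herm_sub_left, herm_smul_left, hqx, mul_one, herm_smul_right,
      map_div₀, herm_conj, Complex.conj_ofNat, hxq, hq, mul_zero, sub_zero]
    ring
  · simp [hxc, hqc]
  · simp [hxq, hq]

namespace HeisenbergFrame

attribute [simp] vv vc vq cc cq qq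

variable (F : HeisenbergFrame)

@[simp]
lemma cv : herm F.c F.v = 0 := herm_eq_zero_comm.1 F.vc

@[simp]
lemma qc : herm F.q F.c = 0 := herm_eq_zero_comm.1 F.cq

@[simp]
lemma qv : herm F.q F.v = 1 := by rw [← herm_conj, F.vq, map_one]

lemma linearIndependent : LinearIndependent ℂ ![F.v, F.c, F.q] := by
  refine Fintype.linearIndependent_iff.2 fun a ha => ?_
  rw [Fin.sum_univ_three] at ha
  have pairing (w : Fin 3 → ℂ) := congrArg (herm · w) ha
  have h0 : a 0 = 0 := by simpa using pairing F.q
  have h1 : a 1 = 0 := by simpa using pairing F.c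
  have h2 : a 2 = 0 := by simpa using pairing F.v
  intro i
  fin_cases i <;> assumption

lemma expansion (z : Fin 3 → ℂ) :
    z = herm z F.q • F.v + herm z F.c • F.c + herm z F.v • F.q := by
  have hspan := F.linearIndependent.span_eq_top_of_card_eq_finrank' (by simp)
  have hz : z ∈ Submodule.span ℂ (Set.range ![F.v, F.c, F.q]) := hspan ▸ Submodule.mem_top
  simp only [Matrix.range_cons, Matrix.range_empty, Set.union_empty, Set.singleton_union] at hz
  obtain ⟨a, b, d, rfl⟩ := Submodule.mem_span_triple.1 hz
  simp

lemma ext_herm {z w : Fin 3 → ℂ} (hv : herm z F.v = herm w F.v) (hc : herm z F.c = herm w F.c)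
    (hq : herm z F.q = herm w F.q) : z = w := by
  rw [F.expansion z, F.expansion w, hv, hc, hq]

lemma herm_eq_sum (z w : Fin 3 → ℂ) :
    herm z w = herm z F.q * herm F.v w + herm z F.c * herm F.c w + herm z F.v * herm F.q w := by
  conv_lhs => rw [F.expansion z]
  simp

lemma re_herm_of_null {z p : Fin 3 → ℂ} (hz : herm z z = 0) (hp : herm p p = 0)
    (hzq : herm z F.q = 1) (hpq : herm p F.q = 1) :
    (herm z p).re = -‖herm z F.c - herm p F.c‖ ^ 2 / 2 := by
  set s := z - p
  have hsq : herm s F.q = 0 := by simp [s, hzq, hpq]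
  have hss : herm s s = herm s F.c * herm F.c s := by
    rw [F.herm_eq_sum s s, hsq, herm_eq_zero_comm.1 hsq]; ring
  have hsc : herm s F.c = herm z F.c - herm p F.c := by simp [s]
  have hre : herm s s = -(herm z p + conj (herm z p)) := by
    simp only [herm_sub_right, herm_sub_left, hz, zero_sub, hp, sub_zero, herm_conj,
      neg_add_rev, s]
    ring
  rw [herm_mul_herm_symm, hre, Complex.add_conj, hsc] at hss
  have : -(2 * (herm z p).re) = ‖herm z F.c - herm p F.c‖ ^ 2 := by exact_mod_cast hss
  linarith

variable {F} {A : U21} (hA : A • F.q = F.q)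

include hA

lemma herm_smul_q_of_fix (z : Fin 3 → ℂ) : herm (A • z) F.q = herm z F.q := by
  conv_lhs => rw [← hA, herm_u21_smul]

lemma herm_smul_eq_sum (z w : Fin 3 → ℂ) : herm (A • z) w =
    herm z F.q * herm (A • F.v) w + herm z F.c * herm (A • F.c) w + herm z F.v * herm F.q w := by
  conv_lhs => rw [F.expansion z, smul_add, smul_add, smul_comm A, smul_comm A, smul_comm A, hA]
  simp

lemma herm_smul_c_v : herm (A • F.c) F.v =
    -(herm (A • F.c) F.c * conj (herm (A • F.v) F.c)) := by
  have h := F.herm_eq_sum (A • F.c) (A • F.v)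
  rw [herm_u21_smul, F.cv, herm_smul_q_of_fix hA, F.cq, ← herm_conj (A • F.v) F.q,
    herm_smul_q_of_fix hA, F.vq, map_one, mul_one, zero_mul, zero_add] at h
  rw [herm_conj]
  linear_combination -h

lemma smul_eq_add_of_vertical (hc : herm (A • F.c) F.c = 1) (hv : herm (A • F.v) F.c = 0)
    (z : Fin 3 → ℂ) : A • z = z + (herm z F.q * herm (A • F.v) F.v) • F.q := by
  apply F.ext_herm
  · simp [herm_smul_eq_sum hA z, herm_smul_c_v hA, hc, hv, add_comm]
  · simp [herm_smul_eq_sum hA z, hc, hv]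
  · simp [herm_smul_q_of_fix hA]

lemma eq_one_of_fix (hc : herm (A • F.c) F.c = 1) (hv : herm (A • F.v) F.c = 0)
    (hvv : herm (A • F.v) F.v = 0) : A = 1 :=
  u21_ext fun z => by
    rw [smul_eq_add_of_vertical hA hc hv, hvv, mul_zero, zero_smul, add_zero, one_smul]

omit hA

variable (F) in
/-- The subgroup of the Heisenberg isometries fixing `q` whose horizontal part
`z ↦ u z + b` lies in the `(3, 3, 3)`-triangle group with rotation `u` a cube root of unity and
translation `b` in the ideal `(1 - ω)`, and whose vertical part is an Eisenstein integer. -/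
def eisensteinStabilizer : Subgroup U21 where
  carrier := {A | A • F.q = F.q ∧ herm (A • F.c) F.c ^ 3 = 1 ∧
    herm (A • F.v) F.c ∈ eisensteinPrime ∧ herm (A • F.v) F.v ∈ eisenstein}
  one_mem' := by simp
  mul_mem' := by
    rintro A B ⟨hA, hAc, hAb, hAy⟩ ⟨hB, hBc, hBb, hBy⟩
    have hAm := mem_eisenstein_of_cube_eq_one hAc
    refine ⟨by rw [mul_smul, hB, hA], ?_, ?_, ?_⟩
    · rw [mul_smul, herm_smul_eq_sum hA, herm_smul_q_of_fix hB]
      simp [mul_pow, hAc, hBc]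
    · rw [mul_smul, herm_smul_eq_sum hA, herm_smul_q_of_fix hB, F.vq, F.qc, one_mul, mul_zero,
        add_zero, mul_comm]
      exact add_mem hAb (mul_mem_eisensteinPrime hAm hBb)
    · rw [mul_smul, herm_smul_eq_sum hA, herm_smul_q_of_fix hB, F.vq, F.qv, one_mul, mul_one,
        herm_smul_c_v hA]
      exact add_mem (add_mem hAy (mul_mem (mem_eisenstein_of_mem_eisensteinPrime hBb)
        (neg_mem (mul_mem hAm (conj_mem_eisenstein (mem_eisenstein_of_mem_eisensteinPrime hAb))))))
        hBy
  inv_mem' := by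
    rintro A ⟨hA, hAc, hAb, hAy⟩
    refine ⟨inv_smul_eq_iff.2 hA.symm, ?_, ?_, ?_⟩
    · rw [herm_u21_inv_smul, ← herm_conj, ← map_pow, hAc, map_one]
    · rw [herm_u21_inv_smul, ← herm_conj, herm_smul_c_v hA, map_neg, map_mul, Complex.conj_conj]
      exact neg_mem (mul_mem_eisensteinPrime
        (conj_mem_eisenstein (mem_eisenstein_of_cube_eq_one hAc)) hAb)
    · rw [herm_u21_inv_smul, ← herm_conj]
      exact conj_mem_eisenstein hAy

lemma mem_eisensteinStabilizer {A : U21} : A ∈ F.eisensteinStabilizer ↔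
    A • F.q = F.q ∧ herm (A • F.c) F.c ^ 3 = 1 ∧
      herm (A • F.v) F.c ∈ eisensteinPrime ∧ herm (A • F.v) F.v ∈ eisenstein := Iff.rfl

lemma eq_one_of_mem_eisensteinStabilizer (hA : A ∈ F.eisensteinStabilizer)
    (hc : ‖1 - herm (A • F.c) F.c‖ < 1) (hv : ‖herm (A • F.v) F.c‖ < 1)
    (hvv : ‖herm (A • F.v) F.v‖ < 1) : A = 1 := by
  obtain ⟨hAq, hAc, hAb, hAy⟩ := hA
  refine eq_one_of_fix hAq ?_ ?_ ?_
  · refine (sub_eq_zero.1 (eq_zero_of_mem_eisenstein ?_ hc)).symm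
    exact sub_mem (one_mem _) (mem_eisenstein_of_cube_eq_one hAc)
  · exact eq_zero_of_mem_eisenstein (mem_eisenstein_of_mem_eisensteinPrime hAb) hv
  · exact eq_zero_of_mem_eisenstein hAy hvv

/-! ### Isometric spheres and ping-pong -/

variable (F) in
/-- The null vector `p`, in Heisenberg coordinates, is the centre of an isometric sphere
`‖⟨z, q⟩‖ = R ‖⟨z, p⟩‖` whose radius is so small that it is disjoint from its translates under
`F.eisensteinStabilizer`; its horizontal projection lies in the Voronoi cell of the origin. -/
structure IsSeparatedCentre (R : ℝ) (p : Fin 3 → ℂ) : Prop where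
  null : herm p p = 0
  herm_q : herm p F.q = 1
  mem_cell : herm p F.c ∈ eisensteinCell
  le_radius : 8 ≤ 3 * R * ‖herm p F.c‖ ^ 2

namespace IsSeparatedCentre

variable {R : ℝ} {p : Fin 3 → ℂ} (hp : F.IsSeparatedCentre R p)

include hp

lemma eight_le : 8 ≤ R := by
  have h := three_mul_norm_sq_le_one_of_mem_eisensteinCell hp.mem_cell
  have hR : 0 ≤ R := by
    by_contra! hneg
    nlinarith [hp.le_radius, sq_nonneg ‖herm p F.c‖]
  nlinarith [hp.le_radius]

lemma one_lt_of_vertical {z : Fin 3 → ℂ} (hzq : herm z F.q = 1)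
    (hAF : A ∈ F.eisensteinStabilizer) (hA1 : A ≠ 1) (hc : herm (A • F.c) F.c = 1)
    (hv : herm (A • F.v) F.c = 0) (hin : R * ‖herm z p‖ < 1) : 1 < R * ‖herm (A • z) p‖ := by
  obtain ⟨hAq, -, -, hAy⟩ := hAF
  have hy : 1 ≤ ‖herm (A • F.v) F.v‖ :=
    one_le_norm_of_mem_eisenstein hAy fun h => hA1 (eq_one_of_fix hAq hc hv h)
  have hAz : herm (A • z) p = herm z p + herm (A • F.v) F.v := by
    rw [smul_eq_add_of_vertical hAq hc hv z, herm_add_left, herm_smul_left, hzq,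
      ← herm_conj p F.q, hp.herm_q]
    simp
  have triangle : ‖herm (A • F.v) F.v‖ ≤ ‖herm (A • z) p‖ + ‖herm z p‖ := by
    simpa [hAz] using norm_sub_le (herm (A • z) p) (herm z p)
  nlinarith [hp.eight_le]

lemma one_lt_of_not_vertical {z : Fin 3 → ℂ} (hz : herm z z = 0) (hzq : herm z F.q = 1)
    (hAF : A ∈ F.eisensteinStabilizer)
    (hA : herm (A • F.c) F.c ≠ 1 ∨ herm (A • F.v) F.c ≠ 0) (hin : R * ‖herm z p‖ < 1) :
    1 < R * ‖herm (A • z) p‖ := by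
  obtain ⟨hAq, hAc, hAb, -⟩ := hAF
  have hAz : herm (A • z) F.c = herm (A • F.v) F.c + herm (A • F.c) F.c * herm z F.c := by
    rw [herm_smul_eq_sum hAq, hzq, F.qc]; ring
  have hAzq : herm (A • z) F.q = 1 := by rw [herm_smul_q_of_fix hAq, hzq]
  have hcell := three_mul_norm_sq_le hp.mem_cell hAc hAb hA
  have horizontal : ∀ z, herm z z = 0 → herm z F.q = 1 →
      ‖herm z F.c - herm p F.c‖ ^ 2 ≤ 2 * ‖herm z p‖ := fun z hz hzq => by
    have h := Complex.abs_re_le_norm (herm z p)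
    rw [F.re_herm_of_null hz hp.null hzq hp.herm_q, abs_le] at h
    linarith
  have hs := horizontal z hz hzq
  have ht := horizontal (A • z) (by simpa using hz) hAzq
  set u := herm (A • F.c) F.c
  set b := herm (A • F.v) F.c
  set w := herm p F.c
  set s := ‖herm z F.c - w‖
  set t := ‖herm (A • z) F.c - w‖
  have triangle : ‖b + u * w - w‖ ≤ t + s := by
    have h : b + u * w - w = (herm (A • z) F.c - w) - u * (herm z F.c - w) := by rw [hAz]; ring
    have hu : ‖u * (herm z F.c - w)‖ = s := by
      rw [norm_mul, Complex.norm_eq_one_of_pow_eq_one hAc three_ne_zero, one_mul]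
    rw [h, ← hu]
    exact norm_sub_le _ _
  -- Horizontally, the isometric sphere lies within `√(2 / R)` of `w`, while `A` displaces `w` by
  -- at least `√3 ‖w‖`.
  by_contra! hout
  have hR := hp.eight_le
  have hst : 3 * ‖w‖ ^ 2 ≤ 2 * (t ^ 2 + s ^ 2) := by
    have := pow_le_pow_left₀ (norm_nonneg _) triangle 2
    nlinarith [sq_nonneg (t - s)]
  nlinarith [hp.le_radius]

lemma norm_herm_lt {z : Fin 3 → ℂ} (hz : herm z z = 0) (hA : A ∈ F.eisensteinStabilizer)
    (hA1 : A ≠ 1) (hin : R * ‖herm z p‖ < ‖herm z F.q‖) :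
    ‖herm z F.q‖ < R * ‖herm (A • z) p‖ := by
  have hR := hp.eight_le
  have hζ : 0 < ‖herm z F.q‖ := lt_of_le_of_lt (by positivity) hin
  set x := (herm z F.q)⁻¹ • z with hx
  have hxq : herm x F.q = 1 := by simp [hx, norm_pos_iff.1 hζ]
  have hxx : herm x x = 0 := by simp [hx, hz]
  have scale : ∀ y, R * ‖herm ((herm z F.q)⁻¹ • y) p‖ = R * ‖herm y p‖ / ‖herm z F.q‖ :=
    fun y => by
      rw [herm_smul_left, norm_mul, norm_inv]; ring
  have hxin : R * ‖herm x p‖ < 1 := by rwa [hx, scale, div_lt_one hζ]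
  rw [← one_lt_div hζ, ← scale, ← smul_comm A]
  by_cases hvert : herm (A • F.c) F.c = 1 ∧ herm (A • F.v) F.c = 0
  · exact hp.one_lt_of_vertical hxq hA hA1 hvert.1 hvert.2 hxin
  · exact hp.one_lt_of_not_vertical hxx hxq hA (not_and_or.1 hvert) hxin

variable {J : U21} (hJ : J * J = 1) (hJq : J • F.q = (R : ℂ) • p)

include hJ hJq

lemma norm_herm_bounds_of_isAlternating {g : U21}
    (hg : IsAlternating F.eisensteinStabilizer J g) :
    R * ‖herm (g • F.q) p‖ < ‖herm (g • F.q) F.q‖ ∧ R ≤ ‖herm (g • F.q) F.q‖ := by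
  have hR := hp.eight_le
  have norm_R : ‖(R : ℂ)‖ = R := by rw [Complex.norm_real, Real.norm_of_nonneg (by linarith)]
  have norm_smul_p (z : Fin 3 → ℂ) : R * ‖herm (J • z) p‖ = ‖herm z F.q‖ := by
    rw [← herm_u21_smul J z, hJq, herm_smul_right, norm_mul, RCLike.norm_conj, norm_R]
  have norm_smul_q (z : Fin 3 → ℂ) : ‖herm (J • z) F.q‖ = R * ‖herm z p‖ := by
    rw [← norm_smul_p, ← mul_smul, hJ, one_smul]
  induction hg with
  | base hg =>
    rw [mul_smul, hg.1, norm_smul_p, norm_smul_q, norm_herm_comm F.q p, hp.herm_q, F.qq,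
      norm_zero, norm_one, mul_one]
    exact ⟨by linarith, le_rfl⟩
  | @step A g hA hA1 _ ih =>
    have key := hp.norm_herm_lt (by simp) hA hA1 ih.1
    rw [mul_smul, mul_smul, norm_smul_p, norm_smul_q, herm_smul_q_of_fix hA.1]
    exact ⟨key, ih.2.trans key.le⟩

lemma mem_eisensteinStabilizer_of_norm_lt {g : U21}
    (hg : g ∈ Subgroup.closure ((F.eisensteinStabilizer : Set U21) ∪ {J}))
    (hlt : ‖herm (g • F.q) F.q‖ < R) : g ∈ F.eisensteinStabilizer := by
  obtain hg | ⟨A, hA, g', hg', rfl⟩ := mem_or_eq_mul_isAlternating_of_mem_closure hJ hg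
  · exact hg
  · have hfar := (hp.norm_herm_bounds_of_isAlternating hJ hJq hg').2
    rw [mul_smul, herm_smul_q_of_fix hA.1] at hlt
    exact absurd hlt hfar.not_gt

end IsSeparatedCentre

end HeisenbergFrame

/-! ### Discreteness -/

lemma discreteTopology_of_isOpen_of_mem {G : Type*} [Group G] [TopologicalSpace G]
    [IsTopologicalGroup G] {N : Subgroup G} [N.Normal] {Γ : Subgroup (G ⧸ N)} {O : Set G}
    (hO : IsOpen O) (h1 : 1 ∈ O) (h : ∀ g ∈ O, (g : G ⧸ N) ∈ Γ → g ∈ N) : DiscreteTopology Γ := by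
  have himage : IsOpen (((↑) : G → G ⧸ N) '' O) := QuotientGroup.isOpenMap_coe _ hO
  have hone : ({1} : Set Γ) = Subtype.val ⁻¹' (((↑) : G → G ⧸ N) '' O) := by
    ext γ
    constructor
    · rintro rfl
      exact ⟨1, h1, rfl⟩
    · rintro ⟨g, hg, hgγ⟩
      refine Subtype.ext (hgγ.symm.trans ((QuotientGroup.eq_one_iff g).2 (h g hg ?_)))
      rw [hgγ]
      exact γ.2
  rw [discreteTopology_iff_isOpen_singleton_one, hone]
  exact himage.preimage continuous_subtype_val

lemma continuous_herm_smul (z w : Fin 3 → ℂ) : Continuous fun A : U21 => herm (A • z) w := by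
  have hsmul : Continuous fun A : U21 => A • z :=
    (Units.continuous_val.comp continuous_subtype_val).matrix_mulVec continuous_const
  unfold herm
  fun_prop

lemma exists_smul_eq_of_mk_eq {A B : U21} (h : (A : PU21) = B) :
    ∃ a : ℂ, ‖a‖ = 1 ∧ ∀ z : Fin 3 → ℂ, B • z = a • A • z := by
  obtain ⟨a, ha⟩ := QuotientGroup.eq.1 h
  have hsmul (z : Fin 3 → ℂ) : (A⁻¹ * B) • z = a • z := by
    rw [u21_smul_def, ha, Matrix.smul_mulVec, Matrix.one_mulVec]
  refine ⟨a, ?_, fun z => ?_⟩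
  · have hnorm := herm_u21_smul (A⁻¹ * B) ![1, 0, 0] ![1, 0, 0]
    rw [hsmul, herm_smul_left, herm_smul_right, ← mul_assoc, Complex.mul_conj'] at hnorm
    have hone : herm ![1, 0, 0] ![1, 0, 0] = 1 := by simp [herm]
    rw [hone, mul_one] at hnorm
    exact (pow_eq_one_iff_of_nonneg (norm_nonneg a) two_ne_zero).1 (by exact_mod_cast hnorm)
  · rw [← smul_comm A, ← hsmul, ← mul_smul, mul_inv_cancel_left]

theorem HeisenbergFrame.IsSeparatedCentre.discreteTopology {F : HeisenbergFrame} {R : ℝ}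
    {p : Fin 3 → ℂ} (hp : F.IsSeparatedCentre R p) {J : U21} (hJ : J * J = 1)
    (hJq : J • F.q = (R : ℂ) • p) {Γ : Subgroup PU21}
    (hΓ : Γ ≤ (Subgroup.closure ((F.eisensteinStabilizer : Set U21) ∪ {J})).map
      (QuotientGroup.mk' scalarU21)) : DiscreteTopology Γ := by
  have hR := hp.eight_le
  have hO : IsOpen {A : U21 | ‖herm (A • F.q) F.q‖ < R ∧ ‖herm (A • F.v) F.c‖ < 1 ∧
      ‖herm (A • F.v) F.v‖ < 1 ∧ ‖herm (A • F.v) F.q - herm (A • F.c) F.c‖ < 1} := by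
    have hcont := continuous_herm_smul
    refine .and ?_ (.and ?_ (.and ?_ ?_)) <;> exact isOpen_lt (by fun_prop) continuous_const
  refine discreteTopology_of_isOpen_of_mem hO ⟨?_, ?_, ?_, ?_⟩ ?_
  · simp only [one_smul, F.qq, norm_zero]
    linarith
  iterate 3 simp
  rintro A ⟨hAq, hAb, hAy, hAc⟩ hA
  obtain ⟨g, hg, hgA⟩ := hΓ hA
  obtain ⟨a, ha, hAg⟩ := exists_smul_eq_of_mk_eq hgA
  simp only [hAg, herm_smul_left, ← mul_sub, norm_mul, ha, one_mul] at hAq hAb hAy hAc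
  have hgF := hp.mem_eisensteinStabilizer_of_norm_lt hJ hJq hg hAq
  rw [herm_smul_q_of_fix hgF.1, F.vq] at hAc
  rw [← QuotientGroup.eq_one_iff, ← hgA, eq_one_of_mem_eisensteinStabilizer hgF hAc hAb hAy,
    map_one]

/-! ### Complex reflections and triangle groups -/

lemma IsComplexReflection.smul {n : ℕ} {c : Fin 3 → ℂ} {g : PU21} (hg : IsComplexReflection n c g)
    {a : ℂ} (ha : a ≠ 0) : IsComplexReflection n (a • c) g := by
  obtain ⟨μ, hμ, A, hA, hAz⟩ := hg
  refine ⟨μ, hμ, A, hA, fun z => ?_⟩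
  have ha' : conj a ≠ 0 := (map_ne_zero _).2 ha
  rw [hAz, smul_smul, herm_smul_right, herm_smul_left, herm_smul_right, mul_left_comm a,
    mul_div_mul_left _ _ ha', mul_assoc, div_mul_eq_mul_div, mul_comm _ a,
    mul_div_mul_left _ _ ha]

/-- `A` is the unitary map `z ↦ -z + (1 - μ) ⟨z, c⟩ c` lifting the complex reflection with
multiplier `μ` in the complex geodesic with normalised polar vector `c`. -/
def IsReflectionLift (μ : ℂ) (c : Fin 3 → ℂ) (A : U21) : Prop :=
  ∀ z : Fin 3 → ℂ, A • z = -z + ((1 - μ) * herm z c) • c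

lemma IsComplexReflection.exists_lift {n : ℕ} {c : Fin 3 → ℂ} {g : PU21}
    (hg : IsComplexReflection n c g) (hc : herm c c = 1) :
    ∃ (μ : ℂ) (A : U21), IsPrimitiveRoot μ n ∧ A = g ∧ IsReflectionLift μ c A := by
  obtain ⟨μ, hμ, A, hA, hAz⟩ := hg
  exact ⟨μ, A, hμ, hA, fun z => by rw [u21_smul_def, hAz, hc, div_one]⟩

lemma IsReflectionLift.mul_self {e : Fin 3 → ℂ} {J : U21} (hJ : IsReflectionLift (-1) e J)
    (he : herm e e = 1) : J * J = 1 := by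
  refine u21_ext fun z => ?_
  rw [mul_smul, hJ (J • z), hJ z, herm_add_left, herm_neg_left, herm_smul_left, he, one_smul]
  module

/-- The scalar matrix `-1` in `U(2, 1)`. Multiplying the lift of a complex reflection by it gives
a lift which fixes the orthogonal complement of the polar vector pointwise. -/
def negOne : U21 := ⟨-1, fun z w => by simp [Matrix.neg_mulVec]⟩

lemma negOne_smul (z : Fin 3 → ℂ) : negOne • z = -z := by
  rw [u21_smul_def]
  simp [negOne, Matrix.neg_mulVec]

lemma mk_negOne_mul (A : U21) : ((negOne * A : U21) : PU21) = A := by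
  have h : (negOne : PU21) = 1 := (QuotientGroup.eq_one_iff _).2 ⟨-1, by simp [negOne]⟩
  rw [QuotientGroup.mk_mul, h, one_mul]

namespace HeisenbergFrame

variable (F : HeisenbergFrame)

lemma negOne_mul_mem_eisensteinStabilizer {t μ : ℂ} (ht : t ∈ eisenstein) (hμ : μ ^ 3 = 1)
    {A : U21} (hA : IsReflectionLift μ (F.c - t • F.q) A) :
    negOne * A ∈ F.eisensteinStabilizer := by
  have hμE := one_sub_mem_eisensteinPrime hμ
  have hsmul (z : Fin 3 → ℂ) : (negOne * A) • z =
      z - ((1 - μ) * (herm z F.c - conj t * herm z F.q)) • (F.c - t • F.q) := by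
    rw [mul_smul, negOne_smul, hA, herm_sub_right, herm_smul_right]
    module
  have hcc : herm ((negOne * A) • F.c) F.c = μ := by simp [hsmul]
  have hvc : herm ((negOne * A) • F.v) F.c = conj t * (1 - μ) := by simp [hsmul, mul_comm]
  have hvv : herm ((negOne * A) • F.v) F.v = -(conj t * (1 - μ) * t) := by
    simp [hsmul, mul_comm]
  refine mem_eisensteinStabilizer.2 ⟨by simp [hsmul], by rw [hcc, hμ], ?_, ?_⟩
  · rw [hvc]
    exact mul_mem_eisensteinPrime (conj_mem_eisenstein ht) hμE
  · rw [hvv]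
    exact neg_mem (mul_mem (mul_mem (conj_mem_eisenstein ht)
      (mem_eisenstein_of_mem_eisensteinPrime hμE)) ht)

lemma exists_isSeparatedCentre {e : Fin 3 → ℂ} (heq : herm e F.q ≠ 0)
    (hcell : herm e F.c / herm e F.q ∈ eisensteinCell) (hec : 4 ≤ 3 * ‖herm e F.c‖ ^ 2)
    {J : U21} (hJ : IsReflectionLift (-1) e J) :
    ∃ (R : ℝ) (p : Fin 3 → ℂ), F.IsSeparatedCentre R p ∧ J • F.q = (R : ℂ) • p := by
  set k := herm e F.q
  have hk : conj k ≠ 0 := (map_ne_zero _).2 heq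
  have hR : ((2 * ‖k‖ ^ 2 : ℝ) : ℂ) = 2 * conj k * k := by
    rw [mul_assoc, Complex.conj_mul']
    push_cast
    rfl
  have hR0 : ((2 * ‖k‖ ^ 2 : ℝ) : ℂ) ≠ 0 := by
    rw [hR]
    exact mul_ne_zero (mul_ne_zero two_ne_zero hk) heq
  have hJq : J • F.q = -F.q + (2 * conj k) • e := by
    rw [hJ, ← herm_conj e F.q, sub_neg_eq_add, one_add_one_eq_two]
  have hpc : herm (((2 * ‖k‖ ^ 2 : ℝ) : ℂ)⁻¹ • J • F.q) F.c = herm e F.c / k := by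
    rw [hJq, hR, herm_smul_left, herm_add_left, herm_neg_left, herm_smul_left, F.qc]
    field_simp
    ring
  refine ⟨2 * ‖k‖ ^ 2, ((2 * ‖k‖ ^ 2 : ℝ) : ℂ)⁻¹ • J • F.q, ⟨?_, ?_, ?_, ?_⟩,
    (smul_inv_smul₀ hR0 _).symm⟩
  · rw [herm_smul_left, herm_smul_right, herm_u21_smul, F.qq, mul_zero, mul_zero]
  · rw [hJq, hR, herm_smul_left, herm_add_left, herm_neg_left, herm_smul_left, F.qq]
    field_simp
    ring
  · rwa [hpc]
  · rw [hpc, norm_div]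
    field_simp
    linarith

end HeisenbergFrame

/-- With phases normalised by `⟨c, d⟩ = 1`, the common boundary point of the asymptotic geodesics
with polar vectors `c` and `d` is represented by the null vector `c - d`. -/
theorem discreteTopology_closure_of_herm_eq_one {c d e : Fin 3 → ℂ} (hc : herm c c = 1)
    (hd : herm d d = 1) (he : herm e e = 1) (hcd : herm c d = 1) (hne : c ≠ d)
    (hnorm : ‖herm e c‖ = ‖herm e d‖) (hec : 4 ≤ 3 * ‖herm e c‖ ^ 2)
    (hre : (herm e c * conj (herm e d)).re ≤ -‖herm e c‖ ^ 2 / 2) {g₁ g₂ g₃ : PU21}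
    (h₁ : IsComplexReflection 3 c g₁) (h₂ : IsComplexReflection 3 d g₂)
    (h₃ : IsComplexReflection 2 e g₃) : DiscreteTopology (Subgroup.closure {g₁, g₂, g₃}) := by
  obtain ⟨μ, A, hμ, rfl, hA⟩ := h₁.exists_lift hc
  obtain ⟨ν, B, hν, rfl, hB⟩ := h₂.exists_lift hd
  obtain ⟨τ, J, hτ, rfl, hJ⟩ := h₃.exists_lift he
  obtain rfl : τ = -1 := hτ.eq_neg_one_of_two_right
  have hdc : herm d c = 1 := by rw [← herm_conj, hcd, map_one]
  obtain ⟨F, rfl, hq⟩ := exists_heisenbergFrame (q := c - d) hc (by simp [hc, hcd])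
    (by simp [hc, hd, hcd, hdc]) (sub_ne_zero.2 hne)
  obtain rfl : d = F.c - F.q := by rw [hq, sub_sub_cancel]
  have hek : herm e F.c - herm e (F.c - F.q) = herm e F.q := by
    rw [← herm_sub_right, sub_sub_cancel]
  have hec0 : herm e F.c ≠ 0 := fun h => by norm_num [h] at hec
  have hk : herm e F.q ≠ 0 := fun h => by
    rw [herm_sub_right, h, sub_zero, Complex.mul_conj', ← Complex.ofReal_pow,
      Complex.ofReal_re] at hre
    linarith
  have hcell := div_sub_mem_eisensteinCell hec0 hnorm hre
  rw [hek] at hcell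
  obtain ⟨R, p, hp, hJq⟩ := F.exists_isSeparatedCentre hk hcell hec hJ
  refine hp.discreteTopology (hJ.mul_self he) hJq ((Subgroup.closure_le _).2 ?_)
  have hAF := F.negOne_mul_mem_eisensteinStabilizer (zero_mem _) hμ.pow_eq_one
    (by simpa using hA)
  have hBF := F.negOne_mul_mem_eisensteinStabilizer (one_mem _) hν.pow_eq_one
    (by simpa using hB)
  rintro _ (rfl | rfl | rfl)
  · exact ⟨_, Subgroup.subset_closure (.inl hAF), mk_negOne_mul A⟩
  · exact ⟨_, Subgroup.subset_closure (.inl hBF), mk_negOne_mul B⟩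
  · exact ⟨J, Subgroup.subset_closure (.inr rfl), rfl⟩

theorem discreteTopology_closure_of_norm_herm_eq_one {c d e : Fin 3 → ℂ} (hc : herm c c = 1)
    (hd : herm d d = 1) (he : herm e e = 1) (hcd : ‖herm c d‖ = 1) (hne : ∀ a : ℂ, c ≠ a • d)
    (hnorm : ‖herm e c‖ = ‖herm e d‖) (hec : 4 ≤ 3 * ‖herm e c‖ ^ 2)
    (hre : (herm e d * herm c e * herm d c).re ≤ -‖herm e c‖ ^ 2 / 2) {g₁ g₂ g₃ : PU21}
    (h₁ : IsComplexReflection 3 c g₁) (h₂ : IsComplexReflection 3 d g₂)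
    (h₃ : IsComplexReflection 2 e g₃) : DiscreteTopology (Subgroup.closure {g₁, g₂, g₃}) := by
  set a := herm c d with ha
  have haa : a * conj a = 1 := by rw [Complex.mul_conj', hcd]; norm_num
  have ha0 : a ≠ 0 := left_ne_zero_of_mul_eq_one haa
  refine discreteTopology_closure_of_herm_eq_one (d := a • d) hc ?_ he ?_ (hne a) ?_ hec ?_ h₁
    (h₂.smul ha0) h₃
  · rw [herm_smul_left, herm_smul_right, hd, mul_one, haa]
  · rw [herm_smul_right, ← ha, mul_comm, haa]
  · rw [herm_smul_right, norm_mul, RCLike.norm_conj, hcd, one_mul, hnorm]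
  · convert hre using 1
    rw [← Complex.conj_re, herm_smul_right]
    simp only [map_mul, herm_conj, ha]
    congr 1
    ring

namespace IsUltraParallelTriangle

variable {m : Fin 3 → ℝ} {c : Fin 3 → Fin 3 → ℂ} (hT : IsUltraParallelTriangle m c)

include hT

lemma norm_herm (k : Fin 3) : ‖herm (c (k - 1)) (c (k + 1))‖ = Real.cosh (m k / 2) := by
  rw [← hT.dist_eq k, cosh_half_setDist (hT.normalised _) (hT.normalised _) (hT.disjoint k)]

lemma re_prod_herm {α : ℝ} (hα : angularInvariant c = α) :
    (∏ k, herm (c (k - 1)) (c (k + 1))).re = (∏ k, Real.cosh (m k / 2)) * Real.cos α := by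
  rw [← Real.Angle.cos_coe, ← hα, angularInvariant, Real.Angle.cos_coe]
  simp only [← hT.norm_herm, ← norm_prod, Complex.norm_mul_cos_arg]

end IsUltraParallelTriangle

lemma four_le_three_mul_sq {x : ℝ} (hx : 2 / Real.sqrt 3 ≤ x) : 4 ≤ 3 * x ^ 2 := by
  have h := pow_le_pow_left₀ (by positivity) hx 2
  rw [div_pow, Real.sq_sqrt (by norm_num)] at h
  linarith

end ComplexHyperbolic

open ComplexHyperbolic

theorem proposition1 (m α : ℝ) (Γ : Subgroup ComplexHyperbolic.PU21)
    (hΓ : ComplexHyperbolic.IsUltraParallelTriangleGroup ![m, m, 0] ![3, 3, 2] α Γ)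
    (hα : Real.cos α ≤ -1 / 2) (hm : 2 / Real.sqrt 3 ≤ Real.cosh (m / 2)) :
    DiscreteTopology Γ := by
  obtain ⟨c, hT, hang, ι, hι, rfl⟩ := hΓ
  have h21 : ‖herm (c 2) (c 1)‖ = Real.cosh (m / 2) := hT.norm_herm 0
  have h20 : ‖herm (c 2) (c 0)‖ = Real.cosh (m / 2) :=
    (norm_herm_comm _ _).trans (hT.norm_herm 1)
  have h01 : ‖herm (c 0) (c 1)‖ = 1 := by
    simpa [norm_herm_comm (c 0)] using hT.norm_herm 2
  have hre := hT.re_prod_herm hang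
  rw [Fin.prod_univ_three, Fin.prod_univ_three] at hre
  have hrange : Set.range ι = {ι 0, ι 1, ι 2} := by
    ext; simp [Fin.exists_fin_succ, eq_comm]
  rw [hrange]
  refine discreteTopology_closure_of_norm_herm_eq_one (hT.normalised 0) (hT.normalised 1)
    (hT.normalised 2) h01 (ne_smul_of_disjoint (by simp [hT.normalised]) (hT.disjoint 2))
    (h20.trans h21.symm) (h20 ▸ four_le_three_mul_sq hm) ?_ (hι 0) (hι 1) (hι 2)
  calc _ = Real.cosh (m / 2) * Real.cosh (m / 2) * Real.cosh (0 / 2) * Real.cos α := hre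
    _ ≤ -‖herm (c 2) (c 0)‖ ^ 2 / 2 := by rw [h20, zero_div, Real.cosh_zero]; nlinarith
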